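/- Let $B$ be a connected locally finite poset (every element has only finitely many elements below it), regarded as a topological space whose open sets are the lower sets, and let $G$ be a group. Write $x\prec y$ if $y$ covers $x$ in $B$. An edge-path from $x$ to $y$ is a finite (possibly empty) sequence of consecutive edges of the Hasse diagram of $B$ leading from $x$ to $y$, each traversed upwards or downwards; it is monotonic if all its edges are traversed upwards, or all downwards. A $G$-coloring $c$ of $B$ assigns an element $c(x,y)\in G$ to every pair $x\prec y$; put $c(y,x)=c(x,y)^{-1}$. The weight of an edge-path $(x_0,x_1)(x_1,x_2)\cdots(x_{n-1},x_n)$ is $c(x_0,x_1)c(x_1,x_2)\cdots c(x_{n-1},x_n)$, and the weight of the empty edge-path is $1$. The coloring $c$ is admissible if for all $x\le y$ any two monotonic edge-paths from $x$ to $y$ have the same weight; it is connected if every $g\in G$ is the weight of a closed edge-path at a base point $x_0\in B$ (the choice of $x_0$ is irrelevant). Two $G$-colorings $c,c'$ are equivalent if there are an automorphism $\varphi$ of $G$ and elements $g_x\in G$ $(x\in B)$ such that $c'(x,y)=\varphi(g_x\,c(x,y)\,g_y^{-1})$ whenever $x\prec y$. Let $E(c)$ be the set $B\times G$ with the partial order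 generated by the relations $(x,g)\prec(y,g\,c(x,y))$ for $x\prec y$ in $B$, with the topology of lower sets, and let $p(c)\colon E(c)\to B$ be the projection $(x,g)\mapsto x$. A covering $p\colon E\to B$ is regular if $E$ is connected and its group $\operatorname{Deck}(p)$ of deck transformations acts transitively on each fiber; coverings $p\colon E\to B$ and $p'\colon E'\to B$ are equivalent if there is a homeomorphism $h\colon E\to E'$ with $p'h=p$. If $c$ is an admissible connected $G$-coloring of $B$, then $p(c)\colon E(c)\to B$ is a regular covering of $B$ with $\operatorname{Deck}(p(c))\cong G$. If $c$ and $c'$ are equivalent admissible connected $G$-colorings of $B$, then $p(c)$ and $p(c')$ are equivalent coverings of $B$. The induced map $[c]\mapsto[p(c)]$ is a bijection from the set of equivalence classes of admissible connected $G$-colorings of $B$ onto the set of equivalence classes of regular coverings $p\colon E\to B$ with $\operatorname{Deck}(p)\cong G$. -/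

import Mathlib

universe u v w

namespace PosetColoring

section Colorings

variable {B : Type u} [PartialOrder B] {G : Type v} [Group G]

/-- A poset is locally finite if every element has only finitely many elements below it. -/
def LocallyFinitePoset (B : Type u) [PartialOrder B] : Prop :=
  ∀ x : B, (Set.Iic x).Finite

/-- Edge-paths in the Hasse diagram of `B`; an edge `x ⋖ y` may be traversed upwards (from `x`
to `y`) or downwards (from `y` to `x`). -/
inductive EdgePath : B → B → Type u
  | nil (x : B) : EdgePath x x
  | up {x y z : B} (h : x ⋖ y) (ξ : EdgePath y z) : EdgePath x z
  | down {x y z : B} (h : y ⋖ x) (ξ : EdgePath y z) : EdgePath x z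

/-- All edges of the path are traversed upwards. -/
def EdgePath.IsAscending : ∀ {x y : B}, EdgePath x y → Prop
  | _, _, .nil _ => True
  | _, _, .up _ ξ => ξ.IsAscending
  | _, _, .down _ _ => False

/-- All edges of the path are traversed downwards. -/
def EdgePath.IsDescending : ∀ {x y : B}, EdgePath x y → Prop
  | _, _, .nil _ => True
  | _, _, .up _ _ => False
  | _, _, .down _ ξ => ξ.IsDescending

/-- An edge-path is monotonic if it is ascending or descending. -/
def EdgePath.IsMonotonic {x y : B} (ξ : EdgePath x y) : Prop :=
  ξ.IsAscending ∨ ξ.IsDescending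

/-- A `G`-coloring of `B`: an element of `G` for each edge `x ⋖ y` of the Hasse diagram. -/
abbrev Coloring (B : Type u) [PartialOrder B] (G : Type v) : Type (max u v) :=
  ∀ x y : B, x ⋖ y → G

/-- The weight of an edge-path: the ordered product of the colors of its edges, where an edge
traversed downwards contributes the inverse of its color. -/
def weight (c : Coloring B G) : ∀ {x y : B}, EdgePath x y → G
  | _, _, .nil _ => 1
  | x, _, .up (y := y) h ξ => c x y h * weight c ξ
  | x, _, .down (y := y) h ξ => (c y x h)⁻¹ * weight c ξ

/-- Any two monotonic edge-paths from `x` to `y`, where `x ≤ y`, have the same weight. -/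
def Admissible (c : Coloring B G) : Prop :=
  ∀ x y : B, x ≤ y → ∀ ξ ξ' : EdgePath x y, ξ.IsMonotonic → ξ'.IsMonotonic →
    weight c ξ = weight c ξ'

/-- Every element of `G` is the weight of a closed edge-path at the base point. On a connected
poset this does not depend on the base point, so we ask for it at every point. -/
def ConnectedColoring (c : Coloring B G) : Prop :=
  ∀ (x₀ : B) (g : G), ∃ ξ : EdgePath x₀ x₀, weight c ξ = g

/-- Equivalence of colorings. -/
def ColoringEquiv (c c' : Coloring B G) : Prop :=
  ∃ (φ : G ≃* G) (g : B → G), ∀ (x y : B) (h : x ⋖ y), c' x y h = φ (g x * c x y h * (g y)⁻¹)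

theorem ColoringEquiv.refl (c : Coloring B G) : ColoringEquiv c c :=
  ⟨MulEquiv.refl G, fun _ => 1, by simp⟩

theorem ColoringEquiv.symm {c c' : Coloring B G} (h : ColoringEquiv c c') :
    ColoringEquiv c' c := by
  obtain ⟨φ, g, h⟩ := h
  refine ⟨φ.symm, fun x => φ (g x)⁻¹, fun x y hxy => ?_⟩
  simp [h, mul_assoc]

theorem ColoringEquiv.trans {c c' c'' : Coloring B G} (h : ColoringEquiv c c')
    (h' : ColoringEquiv c' c'') : ColoringEquiv c c'' := by
  obtain ⟨φ, g, h⟩ := h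
  obtain ⟨ψ, k, h'⟩ := h'
  refine ⟨φ.trans ψ, fun x => φ.symm (k x) * g x, fun x y hxy => ?_⟩
  simp [h, h', mul_assoc]

/-- The admissible connected `G`-colorings of `B`. -/
def ACColoring (B : Type u) [PartialOrder B] (G : Type v) [Group G] : Type (max u v) :=
  {c : Coloring B G // Admissible c ∧ ConnectedColoring c}

instance ACColoring.setoid : Setoid (ACColoring B G) where
  r c c' := ColoringEquiv c.1 c'.1
  iseqv := ⟨fun c => ColoringEquiv.refl c.1, ColoringEquiv.symm, ColoringEquiv.trans⟩

/-- The underlying set `B × G` of the poset `E(c)`. -/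
@[ext]
structure ColorSpace (c : Coloring B G) : Type (max u v) where
  base : B
  elt : G

/-- The generating relations `(x, g) ≺ (y, g · c(x, y))` for `x ⋖ y`. -/
def ColorSpace.Step {c : Coloring B G} (a b : ColorSpace c) : Prop :=
  ∃ h : a.base ⋖ b.base, b.elt = a.elt * c a.base b.base h

theorem ColorSpace.base_le {c : Coloring B G} {a b : ColorSpace c}
    (h : Relation.ReflTransGen ColorSpace.Step a b) : a.base ≤ b.base := by
  induction h with
  | refl => exact le_rfl
  | tail _ h ih => exact ih.trans h.1.le

theorem ColorSpace.eq_of_base_le {c : Coloring B G} {a b : ColorSpace c}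
    (h : Relation.ReflTransGen ColorSpace.Step a b) (h' : b.base ≤ a.base) : a = b := by
  rcases Relation.ReflTransGen.cases_head h with h | ⟨d, hd, hdb⟩
  · exact h
  · exact absurd (hd.1.lt.trans_le ((ColorSpace.base_le hdb).trans h')) (lt_irrefl _)

/-- The order of `E(c)` is the one generated by `ColorSpace.Step`. -/
instance ColorSpace.partialOrder (c : Coloring B G) : PartialOrder (ColorSpace c) where
  le := Relation.ReflTransGen ColorSpace.Step
  le_refl _ := Relation.ReflTransGen.refl
  le_trans _ _ _ := Relation.ReflTransGen.trans
  le_antisymm _ _ h h' := ColorSpace.eq_of_base_le h (ColorSpace.base_le h')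

/-- The open sets of the poset `E(c)` are its lower sets. -/
instance ColorSpace.topologicalSpace (c : Coloring B G) : TopologicalSpace (ColorSpace c) :=
  Topology.lowerSet (ColorSpace c)

/-- The projection `p(c) : E(c) → B`. -/
def ColorSpace.proj (c : Coloring B G) (a : ColorSpace c) : B := a.base

end Colorings

section Coverings

variable {B : Type u} [TopologicalSpace B]

/-- The group of deck transformations of `p`, under composition. -/
def Deck {E : Type w} [TopologicalSpace E] (p : E → B) : Subgroup (E ≃ₜ E) where
  carrier := {h | ∀ e, p (h e) = p e}
  mul_mem' := by
    intro a b ha hb e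
    exact (ha (b e)).trans (hb e)
  one_mem' := fun _ => rfl
  inv_mem' := by
    intro a ha e
    have h := ha (a.symm e)
    rw [a.apply_symm_apply] at h
    exact h.symm

/-- A regular covering: a surjective covering map with connected total space whose deck
transformation group acts transitively on every fiber. -/
structure IsRegularCovering {E : Type w} [TopologicalSpace E] (p : E → B) : Prop where
  connected : ConnectedSpace E
  isCoveringMap : IsCoveringMap p
  surjective : Function.Surjective p
  transitive : ∀ e e' : E, p e = p e' → ∃ h ∈ Deck p, h e = e'

/-- Two coverings of `B` are equivalent if there is a homeomorphism over `B` between them. -/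
def CoveringEquiv {E : Type v} [TopologicalSpace E] {E' : Type w} [TopologicalSpace E']
    (p : E → B) (p' : E' → B) : Prop :=
  ∃ h : E ≃ₜ E', ∀ e, p' (h e) = p e

/-- The regular coverings of `B` whose deck transformation group is isomorphic to `G`. -/
structure RegularCovering (B : Type u) [TopologicalSpace B] (G : Type v) [Group G] where
  total : Type w
  [top : TopologicalSpace total]
  proj : total → B
  regular : IsRegularCovering proj
  deck : Nonempty (Deck proj ≃* G)

attribute [instance] RegularCovering.top

instance RegularCovering.setoid (G : Type v) [Group G] :
    Setoid (RegularCovering.{u, v, w} B G) where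
  r C C' := CoveringEquiv C.proj C'.proj
  iseqv :=
    { refl := fun C => ⟨Homeomorph.refl C.total, fun _ => rfl⟩
      symm := by
        rintro C C' ⟨h, hh⟩
        refine ⟨h.symm, fun e => ?_⟩
        rw [← hh, h.apply_symm_apply]
      trans := by
        rintro C C' C'' ⟨h, hh⟩ ⟨k, hk⟩
        exact ⟨h.trans k, fun e => (hk (h e)).trans (hh e)⟩ }

end Coverings

/-- The projection `p(c) : E(c) → B` as a regular covering with deck group isomorphic to `G`. -/
def coveringOf {B : Type u} [PartialOrder B] [TopologicalSpace B] {G : Type v} [Group G]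
    (c : Coloring B G)
    (h : IsRegularCovering (ColorSpace.proj c) ∧ Nonempty (Deck (ColorSpace.proj c) ≃* G)) :
    RegularCovering.{u, v, max u v} B G where
  total := ColorSpace c
  proj := ColorSpace.proj c
  regular := h.1
  deck := h.2

end PosetColoring

open Topology

namespace PosetColoring

/-! A point of `E(c)` lies below another exactly when an ascending path, weighted by `c`, joins
them. Admissibility makes such weights depend only on endpoints, which trivializes `p(c)` over each
`Set.Iic x`; weights of closed paths exhausting `G` make `E(c)` connected. Left multiplication by
`G` is simply transitive on fibers, so by unique lifting it is the whole deck group. Conversely,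
given a regular covering, choose a point `s x` in each fiber. The relation `x ≤ y` lifts uniquely to
a specialization from `s x` to a translate of `s y`, and the translating element is the color
(`RegularCovering.exists_coloring`). A homeomorphism over `B` conjugates the deck groups, giving
`φ`, and moves the points `(x, 1)`, giving `g_x` (`ColoringEquiv.of_coveringEquiv`). -/

theorem continuous_of_specializes {X : Type*} {Y : Type*} [TopologicalSpace X]
    [AlexandrovDiscrete X] [TopologicalSpace Y] {f : X → Y} (h : ∀ x y, x ⤳ y → f x ⤳ f y) :
    Continuous f :=
  continuous_def.2 fun _ hs => isOpen_iff_forall_specializes.2 fun _ _ hxy hy =>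
    (h _ _ hxy).mem_open hs hy

/-! ### Edge-paths in a locally finite poset -/

section Paths

variable {B : Type u} [PartialOrder B] {G : Type v} [Group G]

theorem LocallyFinitePoset.reflTransGen (hB : LocallyFinitePoset B) {x y : B} (h : x ≤ y) :
    Relation.ReflTransGen (· ⋖ ·) x y := by
  let _ : LocallyFiniteOrder B :=
    LocallyFiniteOrder.ofFiniteIcc fun a b => (hB b).subset Set.Icc_subset_Iic_self
  exact le_iff_reflTransGen_covBy.1 h

theorem LocallyFinitePoset.exists_isAscending (hB : LocallyFinitePoset B) {x y : B} (h : x ≤ y) :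
    ∃ ξ : EdgePath x y, ξ.IsAscending := by
  replace h := hB.reflTransGen h
  induction h using Relation.ReflTransGen.head_induction_on with
  | refl => exact ⟨.nil y, trivial⟩
  | head hab _ ih =>
    obtain ⟨ξ, hξ⟩ := ih
    exact ⟨.up hab ξ, hξ⟩

theorem EdgePath.IsDescending.le {x y : B} {ξ : EdgePath x y} (h : ξ.IsDescending) : y ≤ x := by
  induction ξ with
  | nil => exact le_rfl
  | up => exact h.elim
  | down hxy _ ih => exact (ih h).trans hxy.le

/-- A descending path from a lower to a higher point is empty. -/
theorem EdgePath.IsMonotonic.isAscending {x y : B} {ξ : EdgePath x y} (h : ξ.IsMonotonic)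
    (hxy : x ≤ y) : ξ.IsAscending := by
  rcases h with h | h
  · exact h
  · cases ξ with
    | nil => trivial
    | up => exact h.elim
    | down hlt ξ => exact absurd (hlt.lt.trans_le hxy) (EdgePath.IsDescending.le (ξ := ξ) h).not_gt

theorem LocallyFinitePoset.isClopen [TopologicalSpace B] [Topology.IsLowerSet B]
    (hB : LocallyFinitePoset B) {S : Set B} (hS : ∀ x y, x ⋖ y → (x ∈ S ↔ y ∈ S)) :
    IsClopen S := by
  have key : ∀ x y, x ≤ y → (x ∈ S ↔ y ∈ S) := fun x y hxy => by
    replace hxy := hB.reflTransGen hxy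
    induction hxy with
    | refl => rfl
    | tail _ hbc ih => exact ih.trans (hS _ _ hbc)
  rw [IsClopen, Topology.IsLowerSet.isClosed_iff_isUpper, Topology.IsLowerSet.isOpen_iff_isLowerSet]
  exact ⟨fun x y h => (key x y h).1, fun x y h => (key y x h).2⟩

theorem LocallyFinitePoset.nonempty_edgePath [TopologicalSpace B] [Topology.IsLowerSet B]
    [ConnectedSpace B] (hB : LocallyFinitePoset B) (x y : B) : Nonempty (EdgePath x y) := by
  have h : IsClopen {x : B | Nonempty (EdgePath x y)} := hB.isClopen fun a b hab =>
    ⟨fun ⟨ξ⟩ => ⟨.down hab ξ⟩, fun ⟨ξ⟩ => ⟨.up hab ξ⟩⟩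
  exact (h.eq_univ ⟨y, ⟨.nil y⟩⟩).ge (Set.mem_univ x)

end Paths

/-! ### The covering attached to a coloring -/

namespace ColorSpace

variable {B : Type u} [PartialOrder B] {G : Type v} [Group G] {c : Coloring B G}

instance isLowerSet_topology (c : Coloring B G) : Topology.IsLowerSet (ColorSpace c) := ⟨rfl⟩

theorem Step.le {a b : ColorSpace c} (h : Step a b) : a ≤ b := Relation.ReflTransGen.single h

theorem monotone_proj (c : Coloring B G) : Monotone (proj c) := fun _ _ h => base_le h

theorem le_of_isAscending {x y : B} {ξ : EdgePath x y} (h : ξ.IsAscending) (g : G) :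
    (⟨x, g⟩ : ColorSpace c) ≤ ⟨y, g * weight c ξ⟩ := by
  induction ξ generalizing g with
  | nil => simp [weight]
  | @up x y z hxy ξ ih =>
    rw [weight, ← mul_assoc]
    exact (Step.le (a := ⟨x, g⟩) (b := ⟨y, g * c x y hxy⟩) ⟨hxy, rfl⟩).trans (ih h _)
  | down => exact h.elim

theorem exists_isAscending_of_le {a b : ColorSpace c} (h : a ≤ b) :
    ∃ ξ : EdgePath a.base b.base, ξ.IsAscending ∧ b.elt = a.elt * weight c ξ := by
  replace h : Relation.ReflTransGen Step a b := h
  induction h using Relation.ReflTransGen.head_induction_on with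
  | refl => exact ⟨.nil _, trivial, by simp [weight]⟩
  | head hab _ ih =>
    obtain ⟨ξ, hξ, h⟩ := ih
    obtain ⟨hab, h'⟩ := hab
    exact ⟨.up hab ξ, hξ, by rw [h, h', weight, mul_assoc]⟩

theorem monotone_of_step {α : Type*} [Preorder α] {f : ColorSpace c → α}
    (hf : ∀ a b, Step a b → f a ≤ f b) : Monotone f := fun a b h => by
  replace h : Relation.ReflTransGen Step a b := h
  induction h with
  | refl => exact le_rfl
  | tail _ h ih => exact ih.trans (hf _ _ h)

theorem monotone_leftMul (g : G) :
    Monotone fun a : ColorSpace c => (⟨a.base, g * a.elt⟩ : ColorSpace c) :=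
  monotone_of_step fun a b ⟨hab, h⟩ => Step.le ⟨hab, by simp [h, mul_assoc]⟩

/-- `G` acts on `E(c)` by left multiplication. -/
def leftMul (c : Coloring B G) : G →* Deck (proj c) where
  toFun g :=
    ⟨{  toFun a := ⟨a.base, g * a.elt⟩
        invFun a := ⟨a.base, g⁻¹ * a.elt⟩
        left_inv a := by simp
        right_inv a := by simp
        continuous_toFun := Topology.IsLowerSet.monotone_iff_continuous.1 (monotone_leftMul g)
        continuous_invFun :=
          Topology.IsLowerSet.monotone_iff_continuous.1 (monotone_leftMul g⁻¹) }, fun _ => rfl⟩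
  map_one' := Subtype.ext <| Homeomorph.ext fun a => by
    change (⟨a.base, 1 * a.elt⟩ : ColorSpace c) = a
    simp
  map_mul' g k := Subtype.ext <| Homeomorph.ext fun a => by
    change (⟨a.base, g * k * a.elt⟩ : ColorSpace c) = ⟨a.base, g * (k * a.elt)⟩
    rw [mul_assoc]

@[simp]
theorem leftMul_apply (g : G) (a : ColorSpace c) :
    (leftMul c g).1 a = ⟨a.base, g * a.elt⟩ := rfl

theorem isClopen_iff {S : Set (ColorSpace c)} :
    IsClopen S ↔ ∀ a b, Step a b → (a ∈ S ↔ b ∈ S) := by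
  rw [IsClopen, Topology.IsLowerSet.isClosed_iff_isUpper, Topology.IsLowerSet.isOpen_iff_isLowerSet]
  refine ⟨fun h a b hab => ⟨fun ha => h.1 hab.le ha, fun hb => h.2 hab.le hb⟩, fun h => ?_⟩
  have key : ∀ a b : ColorSpace c, a ≤ b → (a ∈ S ↔ b ∈ S) := fun a b hab => by
    replace hab : Relation.ReflTransGen Step a b := hab
    induction hab with
    | refl => rfl
    | tail _ hbc ih => exact ih.trans (h _ _ hbc)
  exact ⟨fun x y h => (key x y h).1, fun x y h => (key y x h).2⟩

theorem mem_of_isClopen {S : Set (ColorSpace c)} (hS : IsClopen S) {x y : B} (ξ : EdgePath x y)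
    (g : G) (h : (⟨x, g⟩ : ColorSpace c) ∈ S) : (⟨y, g * weight c ξ⟩ : ColorSpace c) ∈ S := by
  rw [isClopen_iff] at hS
  induction ξ generalizing g with
  | nil => simpa [weight] using h
  | @up x y z hxy ξ ih =>
    rw [weight, ← mul_assoc]
    exact ih _ ((hS ⟨x, g⟩ ⟨y, g * c x y hxy⟩ ⟨hxy, rfl⟩).1 h)
  | @down x y z hxy ξ ih =>
    rw [weight, ← mul_assoc]
    exact ih _ ((hS ⟨y, g * (c y x hxy)⁻¹⟩ ⟨x, g⟩ ⟨hxy, by simp⟩).2 h)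

/-- The coloring is connected as soon as its covering space is. -/
theorem connectedColoring [ConnectedSpace (ColorSpace c)] : ConnectedColoring c := by
  intro x₀ g
  -- The points from which some path lifts to one ending at `(x₀, g)`.
  have h : IsClopen {a : ColorSpace c | ∃ ξ : EdgePath a.base x₀, a.elt * weight c ξ = g} := by
    rw [isClopen_iff]
    rintro a b ⟨hab, h⟩
    constructor
    · rintro ⟨ξ, hξ⟩
      exact ⟨.down hab ξ, by rw [weight, h, ← hξ]; group⟩
    · rintro ⟨ξ, hξ⟩
      exact ⟨.up hab ξ, by rw [weight, ← mul_assoc, ← h, hξ]⟩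
  obtain ⟨ξ, hξ⟩ := (h.eq_univ ⟨⟨x₀, g⟩, .nil x₀, by simp [weight]⟩).ge
    (Set.mem_univ (⟨x₀, 1⟩ : ColorSpace c))
  exact ⟨ξ, by simpa using hξ⟩

variable [TopologicalSpace B] [Topology.IsLowerSet B]

theorem connectedSpace [ConnectedSpace B] (hB : LocallyFinitePoset B) (hc : ConnectedColoring c) :
    ConnectedSpace (ColorSpace c) := by
  obtain ⟨x₀⟩ := (inferInstance : Nonempty B)
  have : PreconnectedSpace (ColorSpace c) := by
    refine preconnectedSpace_iff_clopen.2 fun S hS => ?_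
    refine S.eq_empty_or_nonempty.imp id ?_
    rintro ⟨⟨x, g⟩, hxg⟩
    refine Set.eq_univ_of_forall ?_
    rintro ⟨y, k⟩
    obtain ⟨ξ⟩ := hB.nonempty_edgePath x y
    -- A loop at `x` corrects the group coordinate before `ξ` is followed.
    obtain ⟨η, hη⟩ := hc x (g⁻¹ * k * (weight c ξ)⁻¹)
    have := mem_of_isClopen hS ξ _ (mem_of_isClopen hS η g hxg)
    rw [hη] at this
    convert this using 2
    group
  exact { toNonempty := ⟨⟨x₀, 1⟩⟩ }

theorem continuous_proj (c : Coloring B G) : Continuous (proj c) :=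
  Topology.IsLowerSet.monotone_iff_continuous.1 (monotone_proj c)

/-- The smallest neighborhood `Set.Iic x` is evenly covered: transporting the group coordinate along
an ascending path up to `x` labels the sheets. -/
theorem isCoveringMap_proj (hB : LocallyFinitePoset B) (hc : Admissible c) :
    IsCoveringMap (proj c) := by
  intro x
  let _ : TopologicalSpace G := ⊥
  have : DiscreteTopology G := ⟨rfl⟩
  choose ξ hξ using fun y : Set.Iic x => hB.exists_isAscending y.2
  have hU : IsOpen (Set.Iic x) := Topology.IsLowerSet.isOpen_iff_isLowerSet.2 (isLowerSet_Iic x)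
  have hw : ∀ (y z : Set.Iic x) (η : EdgePath y.1 z.1), η.IsAscending →
      weight c η * weight c (ξ z) = weight c (ξ y) := by
    intro y z η hη
    -- Transitivity in `E(c)` replaces concatenation of paths: the composite relation is read back
    -- as one ascending path `ζ`.
    have h := (le_of_isAscending (c := c) hη 1).trans (le_of_isAscending (hξ z) _)
    obtain ⟨ζ, hζ, h⟩ := exists_isAscending_of_le h
    simp only [one_mul] at h
    rw [h]
    exact hc _ _ y.2 _ _ (.inl hζ) (.inl (hξ y))
  let H : proj c ⁻¹' Set.Iic x ≃ₜ Set.Iic x × G :=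
    { toFun a := (⟨a.1.base, a.2⟩, a.1.elt * weight c (ξ ⟨a.1.base, a.2⟩))
      invFun q := ⟨⟨q.1.1, q.2 * (weight c (ξ q.1))⁻¹⟩, q.1.2⟩
      left_inv a := by simp
      right_inv q := by simp
      continuous_toFun := by
        refine ((continuous_proj c).comp continuous_subtype_val).subtype_mk _ |>.prodMk ?_
        refine continuous_of_specializes fun a b hab => ?_
        rw [subtype_specializes_iff, Topology.IsLowerSet.specializes_iff_le] at hab
        obtain ⟨η, hη, h⟩ := exists_isAscending_of_le hab
        rw [specializes_iff_eq, h, mul_assoc, hw ⟨a.1.base, a.2⟩ ⟨b.1.base, b.2⟩ η hη]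
      continuous_invFun := by
        refine Continuous.subtype_mk (continuous_of_specializes ?_) _
        rintro ⟨y, g⟩ ⟨z, k⟩ h
        obtain ⟨hyz, hgk⟩ := specializes_prod.1 h
        rw [subtype_specializes_iff, Topology.IsLowerSet.specializes_iff_le] at hyz
        obtain rfl : g = k := specializes_iff_eq.1 hgk
        rw [Topology.IsLowerSet.specializes_iff_le]
        obtain ⟨η, hη⟩ := hB.exists_isAscending hyz
        convert le_of_isAscending (c := c) hη (g * (weight c (ξ y))⁻¹) using 2
        rw [← hw y z η hη]
        group }
  have h : IsEvenlyCovered (proj c) x G :=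
    ⟨inferInstance, Set.Iic x, le_rfl, hU, hU.preimage (continuous_proj c), H, fun _ => rfl⟩
  exact h.to_isEvenlyCovered_preimage

end ColorSpace

theorem ColoringEquiv.coveringEquiv {B : Type u} [PartialOrder B] {G : Type v} [Group G]
    {c c' : Coloring B G} (h : ColoringEquiv c c') :
    CoveringEquiv (ColorSpace.proj c) (ColorSpace.proj c') := by
  obtain ⟨φ, g, h⟩ := h
  refine ⟨{ toFun := fun a => ⟨a.base, φ (a.elt * (g a.base)⁻¹)⟩
            invFun := fun a => ⟨a.base, φ.symm a.elt * g a.base⟩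
            left_inv := fun a => by simp
            right_inv := fun a => by simp
            continuous_toFun := ?_
            continuous_invFun := ?_ }, fun _ => rfl⟩ <;>
  exact Topology.IsLowerSet.monotone_iff_continuous.1 <| ColorSpace.monotone_of_step
    fun a b ⟨hab, hb⟩ => ColorSpace.Step.le ⟨hab, by simp [h, hb, mul_assoc]⟩

/-- Both maps lift `p` through itself, and lifts from a connected space are unique. -/
theorem Deck.ext_of_apply {B : Type u} [TopologicalSpace B] {E : Type w} [TopologicalSpace E]
    {p : E → B} (hp : IsCoveringMap p) [PreconnectedSpace E] {d d' : Deck p} (e : E)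
    (h : d.1 e = d'.1 e) : d = d' :=
  Subtype.ext <| Homeomorph.ext <| congrFun <|
    hp.eq_of_comp_eq d.1.continuous d'.1.continuous
      (funext fun a => (d.2 a).trans (d'.2 a).symm) e h

/-! ### Deck groups, and injectivity of the classification -/

section Classification

variable {B : Type u} [PartialOrder B] [TopologicalSpace B] [Topology.IsLowerSet B]
  {G : Type v} [Group G]

theorem ColorSpace.isRegularCovering [ConnectedSpace B] (hB : LocallyFinitePoset B)
    (c : ACColoring B G) : IsRegularCovering (proj c.1) where
  connected := connectedSpace hB c.2.2
  isCoveringMap := isCoveringMap_proj hB c.2.1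
  surjective x := ⟨⟨x, 1⟩, rfl⟩
  transitive a b h :=
    ⟨_, (leftMul c.1 (b.elt * a.elt⁻¹)).2, ColorSpace.ext h (inv_mul_cancel_right b.elt a.elt)⟩

theorem ColorSpace.leftMul_bijective [ConnectedSpace B] (hB : LocallyFinitePoset B)
    (c : ACColoring B G) : Function.Bijective (leftMul c.1) := by
  obtain ⟨x₀⟩ := (inferInstance : Nonempty B)
  have := connectedSpace hB c.2.2
  refine ⟨fun g k h => ?_, fun d => ?_⟩
  · have := congrArg (fun d : Deck (proj c.1) => (d.1 ⟨x₀, 1⟩).elt) h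
    simpa using this
  · refine ⟨(d.1 ⟨x₀, 1⟩).elt, Deck.ext_of_apply (isCoveringMap_proj hB c.2.1) ⟨x₀, 1⟩ ?_⟩
    exact ColorSpace.ext (d.2 ⟨x₀, 1⟩).symm (by simp)

/-- The deck transformation group of `p(c)` is `G`. -/
noncomputable def ColorSpace.deckEquiv [ConnectedSpace B] (hB : LocallyFinitePoset B)
    (c : ACColoring B G) : G ≃* Deck (proj c.1) :=
  MulEquiv.ofBijective (leftMul c.1) (leftMul_bijective hB c)

theorem ColoringEquiv.of_coveringEquiv [ConnectedSpace B] (hB : LocallyFinitePoset B)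
    {c c' : ACColoring B G}
    (h : CoveringEquiv (ColorSpace.proj c.1) (ColorSpace.proj c'.1)) :
    ColoringEquiv c.1 c'.1 := by
  obtain ⟨h, hp⟩ := h
  have hp' : ∀ a, (h a).base = a.base := hp
  let κ : Deck (ColorSpace.proj c.1) ≃* Deck (ColorSpace.proj c'.1) :=
    { toFun d := ⟨h.symm.trans (d.1.trans h), fun e => by
        have := d.2 (h.symm e)
        rw [← hp, ← hp, h.apply_symm_apply] at this
        exact this⟩
      invFun d := ⟨h.trans (d.1.trans h.symm), fun e => by
        have := d.2 (h e)
        rw [hp, ← h.apply_symm_apply (d.1 (h e)), hp] at this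
        exact this⟩
      left_inv d := Subtype.ext <| Homeomorph.ext fun e => by simp
      right_inv d := Subtype.ext <| Homeomorph.ext fun e => by simp
      map_mul' d d' := Subtype.ext <| Homeomorph.ext fun e => by simp }
  let φ : G ≃* G := (ColorSpace.deckEquiv hB c).trans (κ.trans (ColorSpace.deckEquiv hB c').symm)
  let k : B → G := fun x => (h ⟨x, 1⟩).elt
  -- `h` is equivariant along `φ`, hence determined by its values at the points `(x, 1)`.
  have hφ : ∀ x g, h ⟨x, g⟩ = ⟨x, φ g * k x⟩ := by
    intro x g
    have h₁ : ColorSpace.leftMul c'.1 (φ g) = κ (ColorSpace.leftMul c.1 g) :=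
      (ColorSpace.deckEquiv hB c').apply_symm_apply _
    have h₂ := congrArg (fun d : Deck (ColorSpace.proj c'.1) => d.1 (h ⟨x, 1⟩)) h₁
    simp only [ColorSpace.leftMul_apply, hp'] at h₂
    rw [h₂]
    simp [κ]
  -- Applying `h` to `(x, 1) ≤ (y, c(x, y))` yields `φ (c(x, y)) * k y = k x * c'(x, y)`, which
  -- dictates the witness.
  refine ⟨φ, fun x => φ.symm (k x)⁻¹, fun x y hxy => ?_⟩
  have hle := Topology.IsLowerSet.monotone_iff_continuous.2 h.continuous
    (ColorSpace.Step.le (c := c.1) (a := ⟨x, 1⟩) (b := ⟨y, c.1 x y hxy⟩) ⟨hxy, by simp⟩)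
  rw [hφ, hφ, map_one, one_mul] at hle
  obtain ⟨ξ, hξ, h⟩ := ColorSpace.exists_isAscending_of_le hle
  have hw : weight c'.1 ξ = c'.1 x y hxy := by
    rw [c'.2.1 x y hxy.le ξ (.up hxy (.nil y)) (.inl hξ) (.inl trivial)]
    simp [weight]
  simp only at h
  rw [hw] at h
  simp [mul_assoc, h]

end Classification

/-! ### Lifting specializations along covering maps -/

section Lifting

variable {B : Type u} [TopologicalSpace B] {E : Type w} [TopologicalSpace E] {p : E → B}

/-- Specializations lift along covering maps, with prescribed generization. -/
theorem IsCoveringMap.exists_specializes (hp : IsCoveringMap p) {e : E} {y : B} (h : p e ⤳ y) :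
    ∃ e', p e' = y ∧ e ⤳ e' := by
  obtain ⟨_, U, hyU, hU, -, H, hH⟩ := hp y
  have heU : p e ∈ U := h.mem_open hU hyU
  refine ⟨H.symm (⟨y, hyU⟩, (H ⟨e, heU⟩).2), by rw [← hH]; simp, ?_⟩
  have h₁ : H ⟨e, heU⟩ ⤳ (⟨y, hyU⟩, (H ⟨e, heU⟩).2) :=
    specializes_prod.2 ⟨(subtype_specializes_iff _ _).2 ((hH ⟨e, heU⟩).symm ▸ h), specializes_rfl⟩
  have h₂ := (h₁.map H.symm.continuous).map continuous_subtype_val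
  rwa [H.symm_apply_apply] at h₂

/-- Distinct points of a fiber have disjoint neighborhoods, but `e` lies in every neighborhood of
either. -/
theorem IsCoveringMap.eq_of_specializes (hp : IsCoveringMap p) {e e₁ e₂ : E} (h₁ : e ⤳ e₁)
    (h₂ : e ⤳ e₂) (h : p e₁ = p e₂) : e₁ = e₂ := by
  by_contra hne
  obtain ⟨U, V, hU, hV, heU, heV, hUV⟩ := hp.isSeparatedMap e₁ e₂ h hne
  exact Set.disjoint_left.1 hUV (h₁.mem_open hU heU) (h₂.mem_open hV heV)

end Lifting

/-! ### Every regular covering comes from a coloring -/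

section Surjectivity

variable {B : Type u} [PartialOrder B] [TopologicalSpace B] [Topology.IsLowerSet B]
  {G : Type v} [Group G]

theorem RegularCovering.exists_coloring (hB : LocallyFinitePoset B)
    (C : RegularCovering.{u, v, w} B G) :
    ∃ c : ACColoring B G, CoveringEquiv (ColorSpace.proj c.1) C.proj := by
  obtain ⟨total, p, hreg, ⟨θ⟩⟩ := C
  have hp := hreg.isCoveringMap
  have := hreg.connected
  choose s hs using hreg.surjective
  have hlift : ∀ x y : B, x ⋖ y → ∃ g : G, s x ⤳ (θ.symm g).1 (s y) := by
    intro x y hxy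
    obtain ⟨e, he, hse⟩ := IsCoveringMap.exists_specializes hp (e := s x) (y := y)
      (by rw [hs]; exact Topology.IsLowerSet.specializes_iff_le.2 hxy.le)
    obtain ⟨d, hd, hde⟩ := hreg.transitive (s y) e ((hs y).trans he.symm)
    exact ⟨θ ⟨d, hd⟩, by simpa [hde] using hse⟩
  choose c hc using hlift
  -- The equivariant map sending `(x, 1)` to `s x`.
  let f : ColorSpace c → total := fun a => (θ.symm a.elt).1 (s a.base)
  have hpf : ∀ a, p (f a) = a.base := fun a => ((θ.symm a.elt).2 _).trans (hs _)
  have hf : ∀ a b, a ≤ b → f a ⤳ f b := by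
    intro a b hab
    replace hab : Relation.ReflTransGen ColorSpace.Step a b := hab
    induction hab with
    | refl => exact specializes_rfl
    | @tail b d _ hbd ih =>
      obtain ⟨hbd, h⟩ := hbd
      refine ih.trans ?_
      have := (hc _ _ hbd).map (θ.symm b.elt).1.continuous
      simpa [f, h] using this
  have hinj : Function.Injective f := by
    intro a b hab
    have hbase : a.base = b.base := by rw [← hpf, ← hpf, hab]
    refine ColorSpace.ext hbase (θ.symm.injective (Deck.ext_of_apply hp (s a.base) ?_))
    simpa only [f, ← hbase] using hab
  have hsurj : Function.Surjective f := by
    intro e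
    obtain ⟨d, hd, hde⟩ := hreg.transitive (s (p e)) e (hs _)
    exact ⟨⟨p e, θ ⟨d, hd⟩⟩, by simpa [f] using hde⟩
  -- Two ascending paths give specializations from `f (x, 1)` to points over `y`; these agree by
  -- uniqueness of lifts, so injectivity of `f` equates the weights.
  have hadm : Admissible c := by
    intro x y hxy ξ ξ' hξ hξ'
    have h := hf _ _ (ColorSpace.le_of_isAscending (c := c) (hξ.isAscending hxy) 1)
    have h' := hf _ _ (ColorSpace.le_of_isAscending (c := c) (hξ'.isAscending hxy) 1)
    have := hinj (IsCoveringMap.eq_of_specializes hp h h' (by rw [hpf, hpf]))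
    simpa using congrArg ColorSpace.elt this
  have hcont : Continuous f := continuous_of_specializes fun a b hab =>
    hf a b (Topology.IsLowerSet.specializes_iff_le.1 hab)
  -- Openness of `f` follows because `p` and `p ∘ f` are both local homeomorphisms.
  have hloc : IsLocalHomeomorph f := by
    refine IsLocalHomeomorph.of_comp (g := p) ?_ hp.isLocalHomeomorph hcont
    rw [show p ∘ f = ColorSpace.proj c from funext hpf]
    exact (ColorSpace.isCoveringMap_proj hB hadm).isLocalHomeomorph
  let F : ColorSpace c ≃ₜ total :=
    (Equiv.ofBijective f ⟨hinj, hsurj⟩).toHomeomorphOfContinuousOpen hcont hloc.isOpenMap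
  have : ConnectedSpace (ColorSpace c) := F.symm.surjective.connectedSpace F.symm.continuous
  exact ⟨⟨c, hadm, ColorSpace.connectedColoring⟩, F, hpf⟩

end Surjectivity

end PosetColoring

theorem theorem3p6 {B : Type u} [PartialOrder B] [TopologicalSpace B] [Topology.IsLowerSet B]
    [ConnectedSpace B] (hB : PosetColoring.LocallyFinitePoset B) {G : Type v} [Group G] :
    -- for an admissible connected coloring, `p(c)` is a regular covering with deck group `G`
    (∃ hreg : ∀ c : PosetColoring.ACColoring B G,
        PosetColoring.IsRegularCovering (PosetColoring.ColorSpace.proj c.1) ∧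
          Nonempty (PosetColoring.Deck (PosetColoring.ColorSpace.proj c.1) ≃* G),
      -- equivalent colorings give equivalent coverings
      ∃ heq : ∀ c c' : PosetColoring.ACColoring B G, c ≈ c' →
          PosetColoring.coveringOf c.1 (hreg c) ≈ PosetColoring.coveringOf c'.1 (hreg c'),
        -- the induced map on equivalence classes is a bijection
        Function.Bijective
          (Quotient.map (fun c : PosetColoring.ACColoring B G =>
              PosetColoring.coveringOf c.1 (hreg c)) heq :
            Quotient (PosetColoring.ACColoring.setoid (B := B) (G := G)) →
              Quotient (PosetColoring.RegularCovering.setoid.{u, v, max u v} (B := B) G))) ∧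
    -- and total spaces in any other universe give no further coverings
    (∀ C : PosetColoring.RegularCovering.{u, v, w} B G, ∃ c : PosetColoring.ACColoring B G,
      PosetColoring.CoveringEquiv (PosetColoring.ColorSpace.proj c.1) C.proj) := by
  refine ⟨⟨fun c => ⟨PosetColoring.ColorSpace.isRegularCovering hB c,
      ⟨(PosetColoring.ColorSpace.deckEquiv hB c).symm⟩⟩,
    fun c c' h => PosetColoring.ColoringEquiv.coveringEquiv h, ?_, ?_⟩,
    fun C => C.exists_coloring hB⟩
  · intro q q'
    induction q, q' using Quotient.inductionOn₂ with
    | h c c' =>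
      intro h
      exact Quotient.sound (PosetColoring.ColoringEquiv.of_coveringEquiv hB (Quotient.exact h))
  · intro q
    induction q using Quotient.inductionOn with
    | h C =>
      obtain ⟨c, hc⟩ := C.exists_coloring hB
      exact ⟨Quotient.mk _ c, Quotient.sound hc⟩
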